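/- **Definitions.** A coarse proximity space $(X,\mathcal B,\mathbf b)$ is a set $X$ with a bornology $\mathcal B$ (a family of "bounded" subsets, containing all singletons and closed under subsets and finite unions) and a relation $\mathbf b$ on the subsets of $X$ such that, for all $A,B,C\subseteq X$: 1. $A\,\mathbf b\,B$ implies $B\,\mathbf b\,A$; 2. $A\,\mathbf b\,B$ implies $A,B\notin\mathcal B$; 3. $A\cap B\notin\mathcal B$ implies $A\,\mathbf b\,B$; 4. $(A\cup B)\,\mathbf b\,C$ if and only if $A\,\mathbf b\,C$ or $B\,\mathbf b\,C$; 5. if not $A\,\mathbf b\,B$, then there is $E\subseteq X$ with neither $A\,\mathbf b\,E$ nor $(X\setminus E)\,\mathbf b\,B$. We write $A\,\bar{\mathbf b}\,B$ if $A\,\mathbf b\,B$ fails, and $C\ll A$ if $C\,\bar{\mathbf b}\,(X\setminus A)$. A coarse proximity map is a function $f:X\to Y$ such that $f(B)$ is bounded for every bounded $B$, and $A\,\mathbf b_X\,B$ implies $f(A)\,\mathbf b_Y\,f(B)$. Let $A\,\delta\,B$ mean that $A\cap B\neq\emptyset$ or $A\,\mathbf b\,B$; this is a separated proximity on $X$.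 A cluster is a nonempty family $\sigma$ of subsets of $X$ such that: $A\,\delta\,B$ for all $A,B\in\sigma$; $A\cup B\in\sigma$ implies $A\in\sigma$ or $B\in\sigma$; and if $C\,\delta\,A$ for all $A\in\sigma$, then $C\in\sigma$. The set $\mathfrak X$ of all clusters is the Smirnov compactification of $(X,\delta)$; its topology is given by the proximity $\mathcal A\,\delta^*\mathcal C$ $\iff$ $A\,\delta\,C$ whenever $A$ belongs to every $\sigma\in\mathcal A$ and $C$ belongs to every $\sigma\in\mathcal C$, i.e. $\mathrm{cl}_{\mathfrak X}(\mathcal A)=\{\sigma : \{\sigma\}\,\delta^*\mathcal A\}$. The space $X$ embeds in $\mathfrak X$ by $x\mapsto\{A : \{x\}\,\delta\,A\}$. The boundary $\mathcal UX\subseteq\mathfrak X$ is the set of clusters with no bounded member, and the trace of $A\subseteq X$ is $tr(A)=\mathrm{cl}_{\mathfrak X}(A)\cap\mathcal UX$. A coarse proximity map $f:X\to Y$ induces $\mathcal Uf:\mathcal UX\to\mathcal UY$, $\mathcal Uf(\sigma)=\{A\subseteq Y : A\,\delta_Y\,f(B)\text{ for all }B\in\sigma\}$. A map is $n$-to-$1$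 if each of its fibres has at most $n$ elements. A finite family $\{A_1,\dots,A_k\}$ of subsets of a coarse proximity space $X$ is gradually disjoint if $A_i\,\bar{\mathbf b}\,A_j$ for all $i\neq j$. It is divergent if $\bigcup_{i=1}^k tr(X\setminus A_i)=\mathcal UX$ and there are sets $D_1,\dots,D_k\subseteq X$ with $D_i\ll X\setminus A_i$ for each $i$ and $\bigcup_{i=1}^k tr(D_i)=\mathcal UX$. **Theorem.** Let $f:X\to Y$ be a coarse proximity map between coarse proximity spaces and let $n\ge 0$ be an integer. The following are equivalent: 1. $\mathcal Uf:\mathcal UX\to\mathcal UY$ is $n$-to-$1$. 2. If $\{A_1,\dots,A_k\}$ is a gradually disjoint family of subsets of $X$ such that $\{f(A_1),\dots,f(A_k)\}$ is not divergent, then $k\le n$. -/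

import Mathlib

namespace CrsProx

universe u v

/-! ### Proximities, clusters and the Smirnov compactification -/

/-- A proximity relation on `X` (not assumed separated). -/
structure Proximity (X : Type u) where
  /-- `Near A B` means that `A` is near `B`. -/
  Near : Set X → Set X → Prop
  not_near_empty : ∀ A, ¬ Near A ∅
  symm : ∀ A B, Near A B → Near B A
  near_of_inter : ∀ A B, (A ∩ B).Nonempty → Near A B
  near_union : ∀ A B C, Near A (B ∪ C) ↔ Near A B ∨ Near A C
  strong : ∀ A B, ¬ Near A B → ∃ E, ¬ Near A Eᶜ ∧ ¬ Near E B

namespace Proximity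

variable {X : Type u} {Y : Type v}

theorem mono_right (δ : Proximity X) {A B C : Set X} (h : δ.Near A B) (hBC : B ⊆ C) :
    δ.Near A C := by
  have := (δ.near_union A B C).2 (Or.inl h)
  rwa [Set.union_eq_self_of_subset_left hBC] at this

theorem mono_left (δ : Proximity X) {A B C : Set X} (h : δ.Near A B) (hAC : A ⊆ C) :
    δ.Near C B :=
  δ.symm _ _ (δ.mono_right (δ.symm _ _ h) hAC)

/-- A proximity map: near sets have near images. -/
def IsMap (δ₁ : Proximity X) (δ₂ : Proximity Y) (f : X → Y) : Prop :=
  ∀ A B : Set X, δ₁.Near A B → δ₂.Near (f '' A) (f '' B)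

/-- A cluster of a proximity space. The type of all clusters is the underlying set of the
Smirnov compactification. -/
@[ext]
structure Cluster (δ : Proximity X) where
  /-- The members of the cluster. -/
  sets : Set (Set X)
  nonempty : sets.Nonempty
  near : ∀ A ∈ sets, ∀ B ∈ sets, δ.Near A B
  union : ∀ A B, A ∪ B ∈ sets → A ∈ sets ∨ B ∈ sets
  mem_of_near : ∀ C, (∀ A ∈ sets, δ.Near C A) → C ∈ sets

/-- The point cluster of `x`: all sets that are near `{x}`. -/
def pointCluster (δ : Proximity X) (x : X) : δ.Cluster where
  sets := {A | δ.Near {x} A}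
  nonempty := ⟨{x}, δ.near_of_inter _ _ ⟨x, rfl, rfl⟩⟩
  near := by
    intro A hA B hB
    by_contra h
    obtain ⟨E, h1, h2⟩ := δ.strong A B h
    by_cases hx : x ∈ E
    · exact h2 (δ.mono_left hB (Set.singleton_subset_iff.2 hx))
    · exact h1 (δ.mono_right (δ.symm _ _ hA) (Set.singleton_subset_iff.2 hx))
  union := fun A B h => (δ.near_union _ A B).1 h
  mem_of_near := fun C h => δ.symm _ _ (h {x} (δ.near_of_inter _ _ ⟨x, rfl, rfl⟩))

/-- `A` absorbs a collection of clusters if it is a member of each of them. -/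
def Absorbs (δ : Proximity X) (A : Set X) (𝒜 : Set δ.Cluster) : Prop :=
  ∀ σ ∈ 𝒜, A ∈ σ.sets

/-- The relation `δ*` of the Smirnov compactification, on sets of clusters. -/
def smirnovNear (δ : Proximity X) (𝒜 ℬ : Set δ.Cluster) : Prop :=
  ∀ A B : Set X, δ.Absorbs A 𝒜 → δ.Absorbs B ℬ → δ.Near A B

/-- The closure operator of the topology induced by `δ*` on the Smirnov compactification. -/
def smirnovClosure (δ : Proximity X) (𝒜 : Set δ.Cluster) : Set δ.Cluster :=
  {σ | δ.smirnovNear {σ} 𝒜}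

theorem Cluster.univ_mem {δ : Proximity X} (σ : δ.Cluster) : Set.univ ∈ σ.sets := by
  apply σ.mem_of_near
  intro A hA
  exact δ.mono_left (σ.near A hA A hA) (Set.subset_univ A)

theorem Cluster.mem_or_compl_mem {δ : Proximity X} (σ : δ.Cluster) (A : Set X) :
    A ∈ σ.sets ∨ Aᶜ ∈ σ.sets := by
  apply σ.union
  rw [Set.union_compl_self]
  exact σ.univ_mem

/-- The extension of a proximity map to the Smirnov compactifications: the cluster `σ` is sent to
`{A | A is near f(B) for all B ∈ σ}`. -/
def Cluster.map {δ₁ : Proximity X} {δ₂ : Proximity Y} (f : X → Y) (hf : IsMap δ₁ δ₂ f)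
    (σ : δ₁.Cluster) : δ₂.Cluster where
  sets := {A | ∀ B ∈ σ.sets, δ₂.Near A (f '' B)}
  nonempty := ⟨f '' Set.univ, fun B hB => hf _ _ (σ.near _ σ.univ_mem B hB)⟩
  near := by
    intro A hA B hB
    by_contra h
    obtain ⟨E, h1, h2⟩ := δ₂.strong A B h
    rcases σ.mem_or_compl_mem (f ⁻¹' E) with hE | hE
    · exact h2 (δ₂.symm _ _ (δ₂.mono_right (hB _ hE) (Set.image_preimage_subset f E)))
    · exact h1 (δ₂.mono_right (hA _ hE) (Set.image_preimage_subset f Eᶜ))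
  union := by
    intro A B hAB
    by_contra h
    rw [not_or] at h
    obtain ⟨h1, h2⟩ := h
    simp only [Set.mem_ofPred_eq, not_forall] at h1 h2
    obtain ⟨D, hD, hAD⟩ := h1
    obtain ⟨E, hE, hBE⟩ := h2
    obtain ⟨P, hAP, hPD⟩ := δ₂.strong _ _ hAD
    obtain ⟨Q, hBQ, hQE⟩ := δ₂.strong _ _ hBE
    rcases σ.mem_or_compl_mem (f ⁻¹' P ∪ f ⁻¹' Q) with hPQ | hPQ
    · rcases σ.union _ _ hPQ with hP | hQ
      · exact hPD (δ₂.mono_left (hf _ _ (σ.near _ hP _ hD)) (Set.image_preimage_subset f P))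
      · exact hQE (δ₂.mono_left (hf _ _ (σ.near _ hQ _ hE)) (Set.image_preimage_subset f Q))
    · rcases (δ₂.near_union _ A B).1 (δ₂.symm _ _ (hAB _ hPQ)) with h | h
      · refine hAP (δ₂.mono_right (δ₂.symm _ _ h) ?_)
        rintro _ ⟨x, hx, rfl⟩ hxP
        exact hx (Or.inl hxP)
      · refine hBQ (δ₂.mono_right (δ₂.symm _ _ h) ?_)
        rintro _ ⟨x, hx, rfl⟩ hxQ
        exact hx (Or.inr hxQ)
  mem_of_near := by
    intro C hC B hB
    exact hC _ (fun B' hB' => hf _ _ (σ.near B hB B' hB'))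

end Proximity

/-! ### Coarse proximity spaces -/

/-- A coarse proximity space: a set with a bornology and a coarse proximity. -/
class CoarseProximitySpace (X : Type u) extends Bornology X where
  /-- `CNear A B` means that `A` is coarsely near `B`. -/
  CNear : Set X → Set X → Prop
  symm : ∀ A B, CNear A B → CNear B A
  unbounded : ∀ A B, CNear A B → ¬ Bornology.IsBounded A ∧ ¬ Bornology.IsBounded B
  near_of_inter : ∀ A B, ¬ Bornology.IsBounded (A ∩ B) → CNear A B
  union_near : ∀ A B C, CNear (A ∪ B) C ↔ CNear A C ∨ CNear B C
  strong : ∀ A B, ¬ CNear A B → ∃ E, ¬ CNear A E ∧ ¬ CNear Eᶜ B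

section

variable {X : Type u} {Y : Type v} [CoarseProximitySpace X] [CoarseProximitySpace Y]

/-- The coarse proximity relation of a coarse proximity space. -/
def CNear (A B : Set X) : Prop := CoarseProximitySpace.CNear A B

theorem CNear.mono {A B A' B' : Set X} (h : CNear A B) (hA : A ⊆ A') (hB : B ⊆ B') :
    CNear A' B' := by
  have h1 : CoarseProximitySpace.CNear A' B := by
    have := (CoarseProximitySpace.union_near A A' B).2 (Or.inl h)
    rwa [Set.union_eq_self_of_subset_left hA] at this
  have h2 := (CoarseProximitySpace.union_near B B' A').2
    (Or.inl (CoarseProximitySpace.symm _ _ h1))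
  rw [Set.union_eq_self_of_subset_left hB] at h2
  exact CoarseProximitySpace.symm _ _ h2

/-- `CoarseNhd C A` (written `C ≪ A`): `A` is a coarse neighbourhood of `C`. -/
def CoarseNhd (C A : Set X) : Prop := ¬ CNear C Aᶜ

/-- A coarse proximity map: it preserves bounded sets and coarse nearness. -/
structure IsCoarseProximityMap (f : X → Y) : Prop where
  bounded_image : ∀ B : Set X, Bornology.IsBounded B → Bornology.IsBounded (f '' B)
  near_image : ∀ A B : Set X, CNear A B → CNear (f '' A) (f '' B)

variable (X) in
/-- The discrete extension of a coarse proximity: sets are near if they meet or are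
coarsely near. -/
def discreteExtension : Proximity X where
  Near A B := (A ∩ B).Nonempty ∨ CNear A B
  not_near_empty := by
    rintro A (h | h)
    · simp at h
    · exact (CoarseProximitySpace.unbounded _ _ h).2 Bornology.isBounded_empty
  symm := by
    rintro A B (h | h)
    · exact Or.inl (by rwa [Set.inter_comm])
    · exact Or.inr (CoarseProximitySpace.symm _ _ h)
  near_of_inter := fun A B h => Or.inl h
  near_union := by
    intro A B C
    constructor
    · rintro (h | h)
      · rw [Set.inter_union_distrib_left, Set.union_nonempty] at h
        exact h.imp Or.inl Or.inl
      · rcases (CoarseProximitySpace.union_near B C A).1 (CoarseProximitySpace.symm _ _ h)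
          with h | h
        · exact Or.inl (Or.inr (CoarseProximitySpace.symm _ _ h))
        · exact Or.inr (Or.inr (CoarseProximitySpace.symm _ _ h))
    · rintro ((h | h) | (h | h))
      · exact Or.inl (h.mono (Set.inter_subset_inter_right _ Set.subset_union_left))
      · exact Or.inr (h.mono subset_rfl Set.subset_union_left)
      · exact Or.inl (h.mono (Set.inter_subset_inter_right _ Set.subset_union_right))
      · exact Or.inr (h.mono subset_rfl Set.subset_union_right)
  strong := by
    intro A B h
    rw [not_or] at h
    obtain ⟨hd, hn⟩ := h
    rw [Set.not_nonempty_iff_eq_empty, Set.eq_empty_iff_forall_notMem] at hd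
    obtain ⟨E, hAE, hEB⟩ := CoarseProximitySpace.strong A B hn
    refine ⟨(Eᶜ ∪ A) \ B, ?_, ?_⟩
    · rintro (⟨x, hxA, hx⟩ | h)
      · exact hx ⟨Or.inr hxA, fun hxB => hd x ⟨hxA, hxB⟩⟩
      · have h' : CNear A (E ∪ B) := by
          refine h.mono subset_rfl ?_
          intro x hx
          by_contra hc
          exact hx ⟨Or.inl fun hxE => hc (Or.inl hxE), fun hxB => hc (Or.inr hxB)⟩
        rcases (CoarseProximitySpace.union_near E B A).1 (CoarseProximitySpace.symm _ _ h')
          with h | h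
        · exact hAE (CoarseProximitySpace.symm _ _ h)
        · exact hn (CoarseProximitySpace.symm _ _ h)
    · rintro (⟨x, hx, hxB⟩ | h)
      · exact hx.2 hxB
      · rcases (CoarseProximitySpace.union_near Eᶜ A B).1 (h.mono Set.sdiff_subset subset_rfl)
          with h | h
        · exact hEB h
        · exact hn h

variable (X) in
/-- The Smirnov compactification of the discrete extension. -/
abbrev Compactification : Type u := (discreteExtension X).Cluster

variable (X) in
/-- The boundary `𝒰X`: the clusters of the discrete extension without bounded members. -/
def boundary : Set (Compactification X) :=
  {σ | ∀ B ∈ σ.sets, ¬ Bornology.IsBounded B}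

/-- The trace of `A`: the closure of `A`, embedded in the Smirnov compactification by
`x ↦ pointCluster x`, intersected with the boundary. -/
def trace (A : Set X) : Set (Compactification X) :=
  (discreteExtension X).smirnovClosure ((discreteExtension X).pointCluster '' A) ∩ boundary X

/-- A finite family of sets is gradually disjoint if its members are pairwise not
coarsely near. -/
def GraduallyDisjoint {k : ℕ} (A : Fin k → Set X) : Prop :=
  ∀ i j, i ≠ j → ¬ CNear (A i) (A j)

/-- A finite family `A` is divergent if the traces of the complements of its members cover the
boundary, and so do the traces of some `D i ≪ (A i)ᶜ`. -/
def Divergent {k : ℕ} (A : Fin k → Set X) : Prop :=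
  (⋃ i, trace (A i)ᶜ) = boundary X ∧
    ∃ D : Fin k → Set X, (∀ i, CoarseNhd (D i) (A i)ᶜ) ∧ (⋃ i, trace (D i)) = boundary X

theorem IsCoarseProximityMap.isMap {f : X → Y} (hf : IsCoarseProximityMap f) :
    Proximity.IsMap (discreteExtension X) (discreteExtension Y) f := by
  rintro A B (⟨x, hxA, hxB⟩ | h)
  · exact Or.inl ⟨f x, ⟨x, hxA, rfl⟩, ⟨x, hxB, rfl⟩⟩
  · exact Or.inr (hf.near_image _ _ h)

/-- The extension of a coarse proximity map to the Smirnov compactifications. -/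
def compactificationMap (f : X → Y) (hf : IsCoarseProximityMap f) :
    Compactification X → Compactification Y :=
  Proximity.Cluster.map f hf.isMap

theorem compactificationMap_mapsTo (f : X → Y) (hf : IsCoarseProximityMap f) :
    Set.MapsTo (compactificationMap f hf) (boundary X) (boundary Y) := by
  intro σ hσ C hC hb
  rcases σ.mem_or_compl_mem (f ⁻¹' C) with h | h
  · have h1 : CNear (f ⁻¹' C) (f ⁻¹' C) :=
      CoarseProximitySpace.near_of_inter _ _ (by rw [Set.inter_self]; exact hσ _ h)
    exact (CoarseProximitySpace.unbounded _ _ (hf.near_image _ _ h1)).1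
      (hb.subset (Set.image_preimage_subset f C))
  · rcases hC _ h with ⟨_, hy, ⟨x, hx, rfl⟩⟩ | h
    · exact hx hy
    · exact (CoarseProximitySpace.unbounded _ _ h).1 hb

/-- The boundary map `𝒰f : 𝒰X → 𝒰Y`. -/
def boundaryMap (f : X → Y) (hf : IsCoarseProximityMap f) : boundary X → boundary Y :=
  (compactificationMap_mapsTo f hf).restrict

end

/-- A map is `n`-to-`1` if each fibre has at most `n` elements. -/
def IsNToOne {α : Type u} {β : Type v} (n : ℕ) (g : α → β) : Prop :=
  ∀ y, (g ⁻¹' {y}).encard ≤ n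

end CrsProx

/-!
Every question about clusters is moved to ultrafilters. An ultrafilter `U` on `X` determines the
cluster of all sets near every member of `U`; each cluster `σ` arises from any ultrafilter
contained in it, and for every `C ∈ σ` there is such an ultrafilter containing `C`
(`Cluster.exists_ultrafilter`). On this level the extension of a proximity map `f` is
`U ↦ U.map f` (`Cluster.map_ofUltrafilter`).

The second ingredient is that a nonempty finite family `A` fails to be divergent exactly when some
boundary cluster contains all the sets `A i`. A boundary cluster cannot contain two sets that are
not coarsely near (`cNear_of_mem_boundary`), which gives one direction; the other one is a
compactness argument, carried out by extending a filter to an ultrafilter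
(`exists_mem_boundary_of_not_divergent`).

Suppose `𝒰f` is `n`-to-`1`, `A` is gradually disjoint and the sets `f(A i)` lie in a common
boundary cluster `τ`. An ultrafilter in `τ` containing `f(A i)` lifts to an ultrafilter containing
`A i`, so `τ` has a preimage containing `A i` (`exists_boundaryMap_eq`). These preimages are
distinct as `A` is gradually disjoint, hence there are at most `n` of them.
Conversely, finitely many distinct points of a fibre contain pairwise far sets
(`Cluster.exists_pairwise_not_near`): ultrafilters, unlike clusters, are closed under finite
intersections. The images of these sets all lie in the common image cluster, so they do not form a
divergent family.
-/

namespace CrsProx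

universe u v

/-! ### Clusters and ultrafilters -/

namespace Proximity

variable {X : Type u} {Y : Type v} {δ : Proximity X}

theorem Cluster.mem_of_superset (σ : δ.Cluster) {A B : Set X} (hA : A ∈ σ.sets) (h : A ⊆ B) :
    B ∈ σ.sets :=
  σ.mem_of_near _ fun C hC => δ.mono_left (σ.near A hA C hC) h

theorem Cluster.empty_notMem (σ : δ.Cluster) : ∅ ∉ σ.sets := fun h =>
  δ.not_near_empty _ (σ.near ∅ h ∅ h)

/-- Clusters are maximal families of pairwise near sets. -/
theorem Cluster.eq_of_subset {σ τ : δ.Cluster} (h : σ.sets ⊆ τ.sets) : σ = τ :=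
  Cluster.ext <| h.antisymm fun A hA => σ.mem_of_near A fun B hB => τ.near A hA B (h hB)

variable (δ) in
/-- The cluster of an ultrafilter: all sets that are near every member of the ultrafilter. -/
def Cluster.ofUltrafilter (U : Ultrafilter X) : δ.Cluster where
  sets := {A | ∀ B ∈ U, δ.Near A B}
  nonempty := by
    refine ⟨Set.univ, fun B hB => δ.near_of_inter _ _ ?_⟩
    rw [Set.univ_inter]
    exact U.nonempty_of_mem hB
  near := by
    intro A hA B hB
    by_contra h
    obtain ⟨E, h1, h2⟩ := δ.strong A B h
    rcases U.mem_or_compl_mem E with hE | hE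
    · exact h2 (δ.symm _ _ (hB E hE))
    · exact h1 (hA _ hE)
  union := by
    intro A B hAB
    by_contra h
    rw [not_or] at h
    obtain ⟨h1, h2⟩ := h
    simp only [Set.mem_ofPred_eq, not_forall] at h1 h2
    obtain ⟨P, hP, hAP⟩ := h1
    obtain ⟨Q, hQ, hBQ⟩ := h2
    have hPQ : P ∩ Q ∈ U := Filter.inter_mem hP hQ
    rcases (δ.near_union _ A B).1 (δ.symm _ _ (hAB _ hPQ)) with h | h
    · exact hAP (δ.mono_right (δ.symm _ _ h) Set.inter_subset_left)
    · exact hBQ (δ.mono_right (δ.symm _ _ h) Set.inter_subset_right)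
  mem_of_near := by
    intro C hC B hB
    refine hC B fun D hD => δ.near_of_inter _ _ ?_
    exact U.nonempty_of_mem (Filter.inter_mem hB hD)

theorem Cluster.mem_ofUltrafilter {U : Ultrafilter X} {A : Set X} (hA : A ∈ U) :
    A ∈ (Cluster.ofUltrafilter δ U).sets := fun _ hB =>
  δ.near_of_inter _ _ (U.nonempty_of_mem (Filter.inter_mem hA hB))

/-- A cluster is determined by any ultrafilter that it contains. -/
theorem Cluster.eq_ofUltrafilter {σ : δ.Cluster} {U : Ultrafilter X}
    (h : ∀ A ∈ U, A ∈ σ.sets) : σ = Cluster.ofUltrafilter δ U :=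
  Cluster.eq_of_subset fun A hA B hB => σ.near A hA B (h B hB)

/-- Every member of a cluster belongs to an ultrafilter contained in the cluster: since the
complement of a cluster is an ideal of sets, the sets `S` with `C \ S` outside the cluster form a
filter, and any finer ultrafilter will do. -/
theorem Cluster.exists_ultrafilter (σ : δ.Cluster) {C : Set X} (hC : C ∈ σ.sets) :
    ∃ U : Ultrafilter X, C ∈ U ∧ ∀ A ∈ U, A ∈ σ.sets := by
  let F : Filter X :=
    { sets := {S | C \ S ∉ σ.sets}
      univ_sets := by simpa using σ.empty_notMem
      sets_of_superset := fun hS h hT =>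
        hS (σ.mem_of_superset hT (Set.sdiff_subset_sdiff_right h))
      inter_sets := by
        intro S T hS hT h
        rw [Set.sdiff_inter] at h
        exact (σ.union _ _ h).elim hS hT }
  have hF : ∀ S, S ∈ F ↔ C \ S ∉ σ.sets := fun S => Iff.rfl
  have : F.NeBot := by
    rw [Filter.neBot_iff, Ne, ← Filter.empty_mem_iff_bot, hF]
    simpa using hC
  obtain ⟨U, hU⟩ := Ultrafilter.exists_le F
  refine ⟨U, hU ((hF C).2 (by simpa using σ.empty_notMem)), fun A hA => ?_⟩
  by_contra h
  refine Ultrafilter.compl_notMem_iff.2 hA (hU ((hF _).2 fun h' => h ?_))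
  exact σ.mem_of_superset h' fun x hx => not_not.1 hx.2

theorem Cluster.exists_mem_of_iUnion_mem (σ : δ.Cluster) {ι : Type*}
    [Finite ι] {D : ι → Set X} (h : ⋃ i, D i ∈ σ.sets) : ∃ i, D i ∈ σ.sets := by
  obtain ⟨U, hU, hσ⟩ := σ.exists_ultrafilter h
  rw [← Set.biUnion_univ] at hU
  obtain ⟨i, -, hi⟩ := (Ultrafilter.finite_biUnion_mem_iff Set.finite_univ).1 hU
  exact ⟨i, hσ _ hi⟩

theorem Cluster.map_ofUltrafilter {δ₂ : Proximity Y} (f : X → Y) (hf : IsMap δ δ₂ f)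
    (U : Ultrafilter X) :
    Cluster.map f hf (Cluster.ofUltrafilter δ U) = Cluster.ofUltrafilter δ₂ (U.map f) := by
  refine Cluster.eq_ofUltrafilter fun A hA B hB => ?_
  exact δ₂.mono_left (hf _ _ (δ.symm _ _ (hB _ hA))) (Set.image_preimage_subset f A)

theorem Cluster.image_mem_map {δ₂ : Proximity Y} (f : X → Y) (hf : IsMap δ δ₂ f)
    (σ : δ.Cluster) {A : Set X} (hA : A ∈ σ.sets) : f '' A ∈ (Cluster.map f hf σ).sets :=
  fun B hB => hf _ _ (σ.near A hA B hB)

/-- Two distinct clusters have far members, and these may be taken from ultrafilters inside the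
clusters; each `A i` is then the intersection of the sets chosen for the pairs involving `i`. -/
theorem Cluster.exists_pairwise_not_near {ι : Type*} [Finite ι] {σ : ι → δ.Cluster}
    (hσ : Function.Injective σ) :
    ∃ A : ι → Set X, (∀ i, A i ∈ (σ i).sets) ∧ ∀ i j, i ≠ j → ¬ δ.Near (A i) (A j) := by
  choose U _ hU using fun i => (σ i).exists_ultrafilter (σ i).univ_mem
  have key : ∀ i j, ∃ P ∈ U i, ∃ Q ∈ U j, i ≠ j → ¬ δ.Near P Q := by
    intro i j
    by_contra! h
    obtain ⟨hij, -⟩ := h Set.univ Filter.univ_mem Set.univ Filter.univ_mem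
    refine hij (hσ ((Cluster.eq_ofUltrafilter fun Q hQ => ?_).trans
      (Cluster.eq_ofUltrafilter (hU j)).symm))
    rw [Cluster.eq_ofUltrafilter (hU i)]
    exact fun P hP => δ.symm _ _ (h P hP Q hQ).2
  choose P hP Q hQ hPQ using key
  refine ⟨fun i => ⋂ j, P i j ∩ Q j i, fun i => hU i _ ?_, fun i j hij h => hPQ i j hij ?_⟩
  · exact Filter.iInter_mem.2 fun j => Filter.inter_mem (hP i j) (hQ j i)
  · exact δ.mono_left (δ.mono_right h ((Set.iInter_subset _ i).trans Set.inter_subset_right))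
      ((Set.iInter_subset _ j).trans Set.inter_subset_left)

end Proximity

open Proximity

/-! ### The boundary, traces and divergent families -/

section

variable {X : Type u} {Y : Type v} [CoarseProximitySpace X] [CoarseProximitySpace Y]

theorem CNear.symm {A B : Set X} (h : CNear A B) : CNear B A :=
  CoarseProximitySpace.symm _ _ h

theorem cNear_union_left {A B C : Set X} : CNear (A ∪ B) C ↔ CNear A C ∨ CNear B C :=
  CoarseProximitySpace.union_near A B C

theorem cNear_of_mem_boundary {σ : Compactification X} (hσ : σ ∈ boundary X) {A B : Set X}
    (hA : A ∈ σ.sets) (hB : B ∈ σ.sets) : CNear A B := by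
  by_contra h
  have hb : Bornology.IsBounded (A ∩ B) := by
    by_contra hb
    exact h (CoarseProximitySpace.near_of_inter _ _ hb)
  -- The bounded set `A ∩ B` can be discarded, so that near sets are coarsely near.
  have hAB : A \ B ∈ σ.sets := by
    rw [← Set.inter_union_sdiff A B] at hA
    exact (σ.union _ _ hA).resolve_left fun h' => hσ _ h' hb
  rcases σ.near _ hAB _ hB with ⟨x, hx, hxB⟩ | h'
  · exact hx.2 hxB
  · exact h (h'.mono Set.sdiff_subset subset_rfl)

theorem mem_trace {A : Set X} {σ : Compactification X} :
    σ ∈ trace A ↔ A ∈ σ.sets ∧ σ ∈ boundary X := by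
  refine and_congr_left fun _ => ⟨fun h => ?_, fun hA B C hB hC => ?_⟩
  · refine σ.mem_of_near _ fun B hB => (discreteExtension X).symm _ _ (h B A ?_ ?_)
    · rintro _ rfl
      exact hB
    · rintro _ ⟨a, ha, rfl⟩
      exact Or.inl ⟨a, rfl, ha⟩
  · refine (discreteExtension X).mono_right (σ.near B (hB σ rfl) A hA) fun a ha => ?_
    -- Singletons are bounded, so they are near only the sets that they meet.
    rcases hC _ ⟨a, ha, rfl⟩ with ⟨_, rfl, h⟩ | h
    · exact h
    · exact absurd Bornology.isBounded_singleton (CoarseProximitySpace.unbounded _ _ h).1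

theorem iUnion_trace_eq_boundary {ι : Type*} {D : ι → Set X} :
    ⋃ i, trace (D i) = boundary X ↔ ∀ σ ∈ boundary X, ∃ i, D i ∈ σ.sets := by
  constructor
  · intro h σ hσ
    rw [← h, Set.mem_iUnion] at hσ
    exact hσ.imp fun i hi => (mem_trace.1 hi).1
  · refine fun h => (Set.iUnion_subset fun i => Set.inter_subset_right).antisymm fun σ hσ => ?_
    obtain ⟨i, hi⟩ := h σ hσ
    exact Set.mem_iUnion.2 ⟨i, mem_trace.2 ⟨hi, hσ⟩⟩

/-- The covering by the traces of the sets `D i` implies the covering by the traces of the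
complements `(A i)ᶜ`, so that divergence is a condition on the `D i` only. -/
theorem divergent_iff {k : ℕ} {A : Fin k → Set X} :
    Divergent A ↔ ∃ D : Fin k → Set X,
      (∀ i, ¬ CNear (D i) (A i)) ∧ ∀ σ ∈ boundary X, ∃ i, D i ∈ σ.sets := by
  simp only [Divergent, CoarseNhd, compl_compl, iUnion_trace_eq_boundary]
  refine ⟨And.right, fun h => ⟨fun σ hσ => ?_, h⟩⟩
  obtain ⟨D, hD, h⟩ := h
  obtain ⟨i, hi⟩ := h σ hσ
  exact ⟨i, (σ.mem_or_compl_mem (A i)).resolve_left fun hA =>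
    hD i (cNear_of_mem_boundary hσ hi hA)⟩

theorem not_divergent_of_mem_boundary {k : ℕ} {A : Fin k → Set X} {σ : Compactification X}
    (hσ : σ ∈ boundary X) (hA : ∀ i, A i ∈ σ.sets) : ¬ Divergent A := by
  rw [divergent_iff]
  rintro ⟨D, hD, h⟩
  obtain ⟨i, hi⟩ := h σ hσ
  exact hD i (cNear_of_mem_boundary hσ hi (hA i))

theorem ofUltrafilter_mem_boundary {U : Ultrafilter X}
    (hU : ∀ B ∈ U, ¬ Bornology.IsBounded B) :
    Cluster.ofUltrafilter (discreteExtension X) U ∈ boundary X := by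
  intro B hB hb
  rcases U.mem_or_compl_mem B with h | h
  · exact hU B h hb
  · rcases hB _ h with ⟨x, hx, hx'⟩ | h'
    · exact hx' hx
    · exact (CoarseProximitySpace.unbounded _ _ h').1 hb

/-- The compactness half of the description of divergence: the unions of sets `D i` with `D i` not
coarsely near `A i` form a proper ideal, and an ultrafilter avoiding this ideal determines a
boundary cluster containing every `A i`. -/
theorem exists_mem_boundary_of_not_divergent {k : ℕ} [NeZero k] {A : Fin k → Set X}
    (h : ¬ Divergent A) : ∃ σ ∈ boundary X, ∀ i, A i ∈ σ.sets := by
  have hempty : ∀ B : Set X, ¬ CNear ∅ B := fun B hB =>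
    (CoarseProximitySpace.unbounded _ _ hB).1 Bornology.isBounded_empty
  let F : Filter X :=
    { sets := {S | ∃ D : Fin k → Set X, (∀ i, ¬ CNear (D i) (A i)) ∧ Sᶜ ⊆ ⋃ i, D i}
      univ_sets := ⟨fun _ => ∅, fun i => hempty _, by simp⟩
      sets_of_superset := by
        rintro S T ⟨D, hD, hS⟩ hST
        exact ⟨D, hD, (Set.compl_subset_compl.2 hST).trans hS⟩
      inter_sets := by
        rintro S T ⟨D, hD, hS⟩ ⟨E, hE, hT⟩
        refine ⟨fun i => D i ∪ E i, fun i hi => (cNear_union_left.1 hi).elim (hD i) (hE i), ?_⟩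
        rw [Set.compl_inter, Set.iUnion_union_distrib]
        exact Set.union_subset_union hS hT }
  have hF : ∀ i E, ¬ CNear E (A i) → Eᶜ ∈ F := by
    refine fun i E hE => ⟨fun j => if j = i then E else ∅, fun j => ?_, ?_⟩
    · by_cases hj : j = i
      · subst hj
        simpa using hE
      · simpa [hj] using hempty _
    · rw [compl_compl]
      exact Set.subset_iUnion_of_subset i (by simp)
  have : F.NeBot := by
    rw [Filter.neBot_iff, Ne, ← Filter.empty_mem_iff_bot]
    rintro ⟨D, hD, hu⟩
    rw [Set.compl_empty] at hu
    exact h (divergent_iff.2 ⟨D, hD, fun σ _ =>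
      σ.exists_mem_of_iUnion_mem (σ.mem_of_superset σ.univ_mem hu)⟩)
  obtain ⟨U, hU⟩ := Ultrafilter.exists_le F
  have key : ∀ E ∈ U, ∀ i, CNear E (A i) := by
    intro E hE i
    by_contra hc
    exact Ultrafilter.compl_notMem_iff.2 hE (hU (hF i E hc))
  refine ⟨_, ofUltrafilter_mem_boundary fun B hB => ?_, fun i B hB => Or.inr (key B hB i).symm⟩
  exact (CoarseProximitySpace.unbounded _ _ (key B hB 0)).1

/-! ### Fibres of the boundary map -/

/-- The lifting step: an ultrafilter in `τ` containing `f '' A` is the image of an ultrafilter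
containing `A`, whose cluster is the required preimage of `τ`. -/
theorem exists_boundaryMap_eq (f : X → Y) (hf : IsCoarseProximityMap f) (τ : boundary Y)
    {A : Set X} (hA : f '' A ∈ τ.1.sets) :
    ∃ σ : boundary X, A ∈ σ.1.sets ∧ boundaryMap f hf σ = τ := by
  obtain ⟨V, hAV, hV⟩ := τ.1.exists_ultrafilter hA
  obtain ⟨U, hAU, hUV⟩ : ∃ U : Ultrafilter X, A ∈ U ∧ U.map f = V :=
    ⟨_, Ultrafilter.ofComapInfPrincipal_mem hAV, Ultrafilter.ofComapInfPrincipal_eq_of_map hAV⟩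
  have hb : Cluster.ofUltrafilter (discreteExtension X) U ∈ boundary X := by
    refine ofUltrafilter_mem_boundary fun B hB hb => τ.2 (f '' B) (hV _ ?_) (hf.bounded_image B hb)
    rw [← hUV]
    exact Filter.image_mem_map hB
  refine ⟨⟨_, hb⟩, Cluster.mem_ofUltrafilter hAU, Subtype.ext ?_⟩
  refine (Cluster.map_ofUltrafilter f hf.isMap U).trans ?_
  rw [hUV, ← Cluster.eq_ofUltrafilter hV]

end

end CrsProx

open CrsProx CrsProx.Proximity in
theorem mainTheorem5 {X : Type*} {Y : Type*}
    [CrsProx.CoarseProximitySpace X] [CrsProx.CoarseProximitySpace Y]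
    (f : X → Y) (hf : CrsProx.IsCoarseProximityMap f) (n : ℕ) :
    CrsProx.IsNToOne n (CrsProx.boundaryMap f hf) ↔
      ∀ (k : ℕ) (A : Fin k → Set X), CrsProx.GraduallyDisjoint A →
        ¬ CrsProx.Divergent (fun i => f '' A i) → k ≤ n := by
  constructor
  · intro h k A hA hdiv
    rcases Nat.eq_zero_or_pos k with rfl | hk
    · exact n.zero_le
    have : NeZero k := ⟨hk.ne'⟩
    obtain ⟨τ, hτ, hAτ⟩ := exists_mem_boundary_of_not_divergent hdiv
    choose σ hAσ hσ using fun i => exists_boundaryMap_eq f hf ⟨τ, hτ⟩ (hAτ i)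
    have hinj : Function.Injective σ := by
      intro i j hij
      by_contra hne
      refine hA i j hne (cNear_of_mem_boundary (σ i).2 (hAσ i) ?_)
      rw [hij]
      exact hAσ j
    have hsub : Set.range σ ⊆ boundaryMap f hf ⁻¹' {⟨τ, hτ⟩} := by
      rintro _ ⟨i, rfl⟩
      exact hσ i
    have := (Set.encard_le_encard hsub).trans (h _)
    rw [← Set.image_univ, hinj.encard_image, Set.encard_univ] at this
    simpa using this
  · intro h τ
    by_contra! hlt
    obtain ⟨t, ht, htc⟩ := Set.exists_subset_encard_eq (Order.add_one_le_of_lt hlt)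
    have htfin : t.Finite := Set.finite_of_encard_eq_coe (k := n + 1) (by simpa using htc)
    have := htfin.to_subtype
    have hcard : Nat.card t = n + 1 := by
      rw [Nat.card_coe_set_eq, Set.ncard, htc]
      rfl
    let e : Fin (n + 1) ≃ t := (Finite.equivFinOfCardEq hcard).symm
    obtain ⟨A, hAσ, hA⟩ := Cluster.exists_pairwise_not_near (σ := fun i => (e i).1.1)
      (Subtype.val_injective.comp (Subtype.val_injective.comp e.injective))
    refine (n.lt_succ_self).not_ge (h (n + 1) A (fun i j hij hc => hA i j hij (Or.inr hc)) ?_)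
    refine not_divergent_of_mem_boundary τ.2 fun i => ?_
    have hi : boundaryMap f hf (e i).1 = τ := ht (e i).2
    rw [← hi]
    exact Cluster.image_mem_map f hf.isMap _ (hAσ i)
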